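/- **Conventions.** A virtual link diagram is a planar 4-valent link diagram whose crossings are either classical (with over/under information) or virtual. Smoothing a classical crossing replaces it by two disjoint arcs: the type $\alpha$ smoothing joins the two regions swept out when the overcrossing strand is turned counterclockwise, the type $\beta$ smoothing joins the two other regions. A state $s$ of a diagram $K$ is a choice of a smoothing type for each classical crossing; $c(s)$ is the number of $\alpha$'s minus the number of $\beta$'s, and $|s|$ is the number of closed curves (which may cross each other virtually) of the smoothed diagram. With $d=-A^{-2}-A^{2}$, the bracket polynomial is $$\langle K\rangle=\sum_{s}A^{c(s)}d^{\,|s|-1}\in\mathbb Z[A,A^{-1}],$$ so $\langle\text{unknot}\rangle=1$ for the crossingless diagram of the unknot. **Family A.** Read a plane diagram from bottom to top, numbering the strands at each height $0,1,2,\dots$ from left to right. Write $\cup_i$ for a minimum creating the strands $i,i+1$; $\cap_i$ for a maximum joining the strands $i,i+1$; $v_i$ for a virtual crossing of the strands $i,i+1$; $\sigma_i$ for a classical crossing of these strands in which the strand from bottom left to top right passes over; and $\sigma_i^{-1}$ for the one in which it passes under. For $t\in\mathbb Z$ let $\sigma_0^{t}$ denote $|t|$ consecutive crossings $\sigma_0^{\pm1}$,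 of the sign of $t$. The virtual knot diagram $K_D(t)$ of Family A is $$\cup_0\;\cup_2\;v_1\;\sigma_0^{\,t}\;\sigma_1^{-1}\,\sigma_0\,\sigma_2^{-1}\,\sigma_2^{-1}\;\cap_1\;\cup_1\;\sigma_2\,\sigma_2\,\sigma_0^{-1}\,\sigma_1\;\sigma_0^{-t}\;v_1\;\cap_2\;\cap_0 ,$$ that is, the diagram $K_D=K_D(0)$, with $8$ classical and $2$ virtual crossings, with $t$ twists inserted in one half and $-t$ twists in the other, mirror-symmetric half. **Theorem.** For every $t\in\mathbb Z$, $$\langle K_D(t)\rangle=1=\langle\text{unknot}\rangle ;$$ no member of Family A is detected by the bracket polynomial. -/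

import Mathlib

/-!
Virtual link diagrams in the plane, put in general position with respect to the height function and
read from bottom to top.  Between two consecutive critical heights a diagram meets a horizontal
line in finitely many points, numbered `0, 1, 2, …` from left to right; every elementary piece
involves the two neighbouring strands `i` and `i + 1`, and all the other strands run upwards.
-/

namespace VirtualKnot

/-- Pieces without classical crossing: a minimum inserting two new strands `i`, `i + 1`; a maximum
joining the strands `i`, `i + 1`; a virtual crossing of the strands `i`, `i + 1`. -/
inductive Piece where
  | cup (i : ℕ)
  | cap (i : ℕ)
  | virt (i : ℕ)

/-- Elementary pieces of a virtual link diagram.  In the classical crossing `over i` the strand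
that runs from the bottom left (position `i`) to the top right (position `i + 1`) is the
overcrossing strand, in `under i` it is the undercrossing strand. -/
inductive Slice where
  | plain (p : Piece)
  | over (i : ℕ)
  | under (i : ℕ)

/-- The number of strands above a piece when there are `n` strands below it. -/
def Piece.width : Piece → ℕ → ℕ
  | .cup _, n => n + 2
  | .cap _, n => n - 2
  | .virt _, n => n

/-- The two strands a piece involves exist when there are `n` strands below it. -/
def Piece.Fits : Piece → ℕ → Prop
  | .cup i, n => i ≤ n
  | .cap i, n => i + 2 ≤ n
  | .virt i, n => i + 2 ≤ n

/-- Starting with `n` strands, all pieces fit and no strand is left at the top. -/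
def ClosesFrom : ℕ → List Slice → Prop
  | n, [] => n = 0
  | n, .plain p :: w => p.Fits n ∧ ClosesFrom (p.width n) w
  | n, .over i :: w => i + 2 ≤ n ∧ ClosesFrom n w
  | n, .under i :: w => i + 2 ≤ n ∧ ClosesFrom n w

/-- A nonempty virtual link diagram in the plane. -/
structure Diagram where
  word : List Slice
  nonempty : word ≠ []
  closed : ClosesFrom 0 word

/-- The number of strands at level `k`, that is, above the first `k` pieces of `w`. -/
def widthAt (w : List Piece) (k : ℕ) : ℕ :=
  (w.take k).foldl (fun n p => p.width n) 0

/-- The points `(k, j)` of a diagram without classical crossings: strand `j` at level `k`. -/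
def Point (w : List Piece) : Type :=
  {x : ℕ × ℕ // x.1 ≤ w.length ∧ x.2 < widthAt w x.1}

/-- Two points are the ends of one segment of the piece number `k`, which lies between the levels
`k` and `k + 1`. -/
inductive Segment (w : List Piece) : ℕ × ℕ → ℕ × ℕ → Prop
  | cupLeft {k i j : ℕ} (h : w[k]? = some (.cup i)) (hj : j < i) : Segment w (k, j) (k + 1, j)
  | cupRight {k i j : ℕ} (h : w[k]? = some (.cup i)) (hj : i ≤ j) :
      Segment w (k, j) (k + 1, j + 2)
  | cupArc {k i : ℕ} (h : w[k]? = some (.cup i)) : Segment w (k + 1, i) (k + 1, i + 1)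
  | capLeft {k i j : ℕ} (h : w[k]? = some (.cap i)) (hj : j < i) : Segment w (k, j) (k + 1, j)
  | capRight {k i j : ℕ} (h : w[k]? = some (.cap i)) (hj : i ≤ j) :
      Segment w (k, j + 2) (k + 1, j)
  | capArc {k i : ℕ} (h : w[k]? = some (.cap i)) : Segment w (k, i) (k, i + 1)
  | virtSide {k i j : ℕ} (h : w[k]? = some (.virt i)) (h₀ : j ≠ i) (h₁ : j ≠ i + 1) :
      Segment w (k, j) (k + 1, j)
  | virtRight {k i : ℕ} (h : w[k]? = some (.virt i)) : Segment w (k, i) (k + 1, i + 1)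
  | virtLeft {k i : ℕ} (h : w[k]? = some (.virt i)) : Segment w (k, i + 1) (k + 1, i)

/-- The number of closed curves of a diagram without classical crossings: the number of classes
of points under the equivalence relation generated by the segments. -/
noncomputable def curves (w : List Piece) : ℕ :=
  Nat.card (Quot fun x y : Point w => Segment w x.1 y.1)

/-- The two types of smoothing of a classical crossing. -/
inductive Smoothing where
  | alpha
  | beta
  deriving DecidableEq

instance : Fintype Smoothing where
  elems := {.alpha, .beta}
  complete := by intro s; cases s <;> simp

/-- The number of classical crossings. -/
def crossings : List Slice → ℕ
  | [] => 0
  | .plain _ :: w => crossings w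
  | .over _ :: w => crossings w + 1
  | .under _ :: w => crossings w + 1

/-- The smoothing of `over i`.  Type `alpha` joins the two regions swept out when the overcrossing
strand is turned counterclockwise, here the lower and the upper one, so that two parallel upward
strands remain; type `beta` leaves a maximum below a minimum. -/
def smoothOver (i : ℕ) : Smoothing → List Piece
  | .alpha => []
  | .beta => [.cap i, .cup i]

/-- The smoothing of `under i`. -/
def smoothUnder (i : ℕ) : Smoothing → List Piece
  | .alpha => [.cap i, .cup i]
  | .beta => []

/-- The diagram without classical crossings obtained by smoothing the classical crossings of `w`,
numbered from bottom to top, as `s` prescribes. -/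
def smooth : (w : List Slice) → (Fin (crossings w) → Smoothing) → List Piece
  | [], _ => []
  | .plain p :: w, s => p :: smooth w s
  | .over i :: w, s => smoothOver i (s (0 : Fin (crossings w + 1))) ++ smooth w fun k => s k.succ
  | .under i :: w, s => smoothUnder i (s (0 : Fin (crossings w + 1))) ++ smooth w fun k => s k.succ

/-- A state assigns a smoothing type to each classical crossing. -/
abbrev Diagram.State (D : Diagram) : Type := Fin (crossings D.word) → Smoothing

/-- `c(s)`: the number of `alpha` smoothings minus the number of `beta` smoothings. -/
def Diagram.State.c {D : Diagram} (s : D.State) : ℤ :=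
  ((Finset.univ.filter fun k => s k = .alpha).card : ℤ) -
    ((Finset.univ.filter fun k => s k = .beta).card : ℤ)

/-- `d = -A⁻² - A²` in `ℤ[A, A⁻¹]`, where `A ^ k` is `LaurentPolynomial.T k`. -/
noncomputable def d : LaurentPolynomial ℤ :=
  -LaurentPolynomial.T (-2) - LaurentPolynomial.T 2

/-- The bracket polynomial `⟨D⟩ = ∑ₛ A ^ c(s) d ^ (|s| - 1)`. -/
noncomputable def Diagram.bracket (D : Diagram) : LaurentPolynomial ℤ :=
  ∑ s : D.State, LaurentPolynomial.T s.c * d ^ (curves (smooth D.word s) - 1)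

/-- The crossingless diagram of the unknot. -/
def unknot : Diagram where
  word := [.plain (.cup 0), .plain (.cap 0)]
  nonempty := by simp
  closed := by simp [ClosesFrom, Piece.Fits, Piece.width]

/-- `t` half twists (of opposite handedness if `t < 0`) of the strands `0` and `1`. -/
def twist (t : ℤ) : List Slice :=
  List.replicate t.natAbs (if 0 ≤ t then .over 0 else .under 0)

/-- The word of `K_D(t)`.  The second half is the mirror image of the first one in a horizontal
line; in particular it contains `-t` twists. -/
def kdWord (t : ℤ) : List Slice :=
  [.plain (.cup 0), .plain (.cup 2), .plain (.virt 1)] ++ twist t ++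
    [.under 1, .over 0, .under 2, .under 2, .plain (.cap 1),
      .plain (.cup 1), .over 2, .over 2, .under 0, .over 1] ++
    twist (-t) ++ [.plain (.virt 1), .plain (.cap 2), .plain (.cap 0)]

theorem closesFrom_twist (t : ℤ) (n : ℕ) (w : List Slice) (hn : 2 ≤ n) (h : ClosesFrom n w) :
    ClosesFrom n (twist t ++ w) := by
  unfold twist
  generalize t.natAbs = m
  induction m with
  | zero => simpa using h
  | succ m ih =>
    split_ifs with ht
    · simp only [ht, if_true] at ih
      exact ⟨by omega, ih⟩
    · simp only [ht, if_false] at ih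
      exact ⟨by omega, ih⟩

theorem closesFrom_kdWord (t : ℤ) : ClosesFrom 0 (kdWord t) := by
  have h₁ := closesFrom_twist (-t) 4
    [.plain (.virt 1), .plain (.cap 2), .plain (.cap 0)] (by norm_num)
    (by simp [ClosesFrom, Piece.Fits, Piece.width])
  have h₂ := closesFrom_twist t 4
    ([.under 1, .over 0, .under 2, .under 2, .plain (.cap 1),
      .plain (.cup 1), .over 2, .over 2, .under 0, .over 1] ++
      (twist (-t) ++ [.plain (.virt 1), .plain (.cap 2), .plain (.cap 0)])) (by norm_num)
    (by simpa [ClosesFrom, Piece.Fits, Piece.width] using h₁)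
  simpa [kdWord, ClosesFrom, Piece.Fits, Piece.width] using h₂

/-- The diagram `K_D(t)`, `t ∈ ℤ`. -/
def KD (t : ℤ) : Diagram where
  word := kdWord t
  nonempty := by simp [kdWord]
  closed := closesFrom_kdWord t

end VirtualKnot

namespace VirtualKnot

open Relation LaurentPolynomial

/-! Smoothing from bottom to top, only the way the strands at the current height are joined in pairs
below matters for what lies above. So d⟨K⟩ is computed by a recursion (`value`) whose states are
such pairings, each closed curve contributing a factor d; for four strands they are the parallel one
`[0, 0, 2, 2]`, the crossed one `[0, 1, 0, 1]` and the nested one `[0, 1, 1, 0]`.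

The bottom of K_D(t) produces the crossed pairing. On the crossed and the parallel pairing the lower
half, up to and including ∩₁, has the same values 1 and d as a single maximum ∩₀ would have
(`value_lower_half_crossed`, `value_lower_half_parallel`). Hence the t twists below it count like
kinks, each giving -A^{∓3} (`value_twist_crossed`). The upper half turns the one remaining arc into
the parallel pairing with coefficient 1 (`value_upper_half`), where the -t twists are kinks
(`value_twist_parallel`). The two twist factors cancel, the top closes one curve, and d⟨K_D(t)⟩ = d.

The link with the definition is `sum_states_eq_value`, which rests on `Tracks.append`: appending a
piece changes the pairing and the number of closed curves as `Piece.act` and `Piece.loops` say. -/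

/-! ### Counting components by representatives. -/

/-- The pair `x` is a point of the diagram `w`. -/
def Valid (w : List Piece) (x : ℕ × ℕ) : Prop :=
  x.1 ≤ w.length ∧ x.2 < widthAt w x.1

/-- Two points are the ends of a segment. -/
def Joined (w : List Piece) (x y : ℕ × ℕ) : Prop :=
  Valid w x ∧ Valid w y ∧ Segment w x y

/-- `f` maps every point to a representative of its component, and `s` is the set of
representatives. -/
structure RootMap (w : List Piece) (f : ℕ × ℕ → ℕ × ℕ) (s : Finset (ℕ × ℕ)) : Prop where
  seg : ∀ {x y}, Joined w x y → f x = f y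
  conn : ∀ {x}, Valid w x → Relation.EqvGen (Joined w) x (f x)
  mem : ∀ {x}, Valid w x → f x ∈ s
  root : ∀ {c}, c ∈ s → Valid w c ∧ f c = c

/-- `EqvGen` is reflexive also at pairs that are not points of the diagram, whence the first
alternative. -/
theorem eqvGen_point_of_eqvGen_joined {w : List Piece} {x y : ℕ × ℕ}
    (h : Relation.EqvGen (Joined w) x y) :
    x = y ∨ ∃ (hx : Valid w x) (hy : Valid w y),
      Relation.EqvGen (fun x y : Point w => Segment w x.1 y.1) ⟨x, hx⟩ ⟨y, hy⟩ := by
  induction h with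
  | rel x y h => exact .inr ⟨h.1, h.2.1, .rel _ _ h.2.2⟩
  | refl x => exact .inl rfl
  | symm x y _ ih =>
    rcases ih with rfl | ⟨hx, hy, h⟩
    · exact .inl rfl
    · exact .inr ⟨hy, hx, h.symm⟩
  | trans x y z _ _ ih₁ ih₂ =>
    rcases ih₁ with rfl | ⟨hx, hy, h⟩
    · exact ih₂
    rcases ih₂ with rfl | ⟨_, hz, h'⟩
    · exact .inr ⟨hx, hy, h⟩
    · exact .inr ⟨hx, hz, h.trans _ _ _ h'⟩

/-- `seg` lets `f` descend to the components, `conn` makes the induced map to `s` injective, and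
`root` makes it surjective. -/
theorem RootMap.curves_eq {w : List Piece} {f : ℕ × ℕ → ℕ × ℕ} {s : Finset (ℕ × ℕ)}
    (h : RootMap w f s) : curves w = s.card := by
  rw [← Nat.card_eq_finsetCard s]
  refine Nat.card_eq_of_bijective
    (Quot.lift (fun x => (⟨f x.1, h.mem x.2⟩ : s)) fun x y hxy =>
      Subtype.ext (h.seg ⟨x.2, y.2, hxy⟩)) ⟨?_, ?_⟩
  · rintro ⟨x⟩ ⟨y⟩ hxy
    have hxy : f x.1 = f y.1 := congrArg Subtype.val hxy
    have hc := (h.conn x.2).trans _ _ _ (hxy ▸ (h.conn y.2).symm)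
    rcases eqvGen_point_of_eqvGen_joined hc with hc | ⟨_, _, hc⟩
    · exact congrArg _ (Subtype.ext hc)
    · exact Quot.eqvGen_sound hc
  · rintro ⟨c, hc⟩
    exact ⟨Quot.mk _ ⟨c, (h.root hc).1⟩, Subtype.ext (h.root hc).2⟩

/-! ### Points and segments after one more piece on top. -/

theorem widthAt_append_of_le (u : List Piece) (p : Piece) {k : ℕ} (hk : k ≤ u.length) :
    widthAt (u ++ [p]) k = widthAt u k := by
  simp [widthAt, List.take_append_of_le_length hk]

theorem widthAt_append_length (u : List Piece) (p : Piece) :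
    widthAt (u ++ [p]) (u.length + 1) = p.width (widthAt u u.length) := by
  simp [widthAt, List.take_of_length_le]

theorem valid_append {u : List Piece} {p : Piece} {x : ℕ × ℕ} :
    Valid (u ++ [p]) x ↔
      Valid u x ∨ x.1 = u.length + 1 ∧ x.2 < p.width (widthAt u u.length) := by
  obtain ⟨k, j⟩ := x
  simp only [Valid, List.length_append, List.length_singleton]
  rcases Nat.lt_trichotomy k (u.length + 1) with hk | rfl | hk
  · rw [widthAt_append_of_le u p (by omega)]
    omega
  · rw [widthAt_append_length]
    omega
  · omega

theorem getElem?_append_singleton_eq_some {u : List Piece} {p q : Piece} {k : ℕ}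
    (h : (u ++ [p])[k]? = some q) : k < u.length ∧ u[k]? = some q ∨ k = u.length ∧ p = q := by
  rcases Nat.lt_trichotomy k u.length with hk | rfl | hk
  · rw [List.getElem?_append_left hk] at h
    exact .inl ⟨hk, h⟩
  · simp at h
    exact .inr ⟨rfl, h⟩
  · rw [List.getElem?_eq_none (by simp; omega)] at h
    cases h

theorem Segment.append {u : List Piece} {x y : ℕ × ℕ} (p : Piece) (h : Segment u x y) :
    Segment (u ++ [p]) x y := by
  have key {k : ℕ} {q : Piece} (h : u[k]? = some q) : (u ++ [p])[k]? = some q := by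
    obtain ⟨hk, -⟩ := List.getElem?_eq_some_iff.1 h
    rwa [List.getElem?_append_left hk]
  cases h with
  | cupLeft h hj => exact .cupLeft (key h) hj
  | cupRight h hj => exact .cupRight (key h) hj
  | cupArc h => exact .cupArc (key h)
  | capLeft h hj => exact .capLeft (key h) hj
  | capRight h hj => exact .capRight (key h) hj
  | capArc h => exact .capArc (key h)
  | virtSide h h₀ h₁ => exact .virtSide (key h) h₀ h₁
  | virtRight h => exact .virtRight (key h)
  | virtLeft h => exact .virtLeft (key h)

theorem Joined.append {u : List Piece} {x y : ℕ × ℕ} (p : Piece) (h : Joined u x y) :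
    Joined (u ++ [p]) x y :=
  ⟨valid_append.2 (.inl h.1), valid_append.2 (.inl h.2.1), h.2.2.append p⟩

/-- The segments of the piece `p` lying between the levels `L` and `L + 1`. -/
def LocalSegment (L : ℕ) : Piece → ℕ × ℕ → ℕ × ℕ → Prop
  | .cup i, x, y => (∃ j, j < i ∧ x = (L, j) ∧ y = (L + 1, j)) ∨
      (∃ j, i ≤ j ∧ x = (L, j) ∧ y = (L + 1, j + 2)) ∨ (x = (L + 1, i) ∧ y = (L + 1, i + 1))
  | .cap i, x, y => (∃ j, j < i ∧ x = (L, j) ∧ y = (L + 1, j)) ∨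
      (∃ j, i ≤ j ∧ x = (L, j + 2) ∧ y = (L + 1, j)) ∨ (x = (L, i) ∧ y = (L, i + 1))
  | .virt i, x, y => (∃ j, j ≠ i ∧ j ≠ i + 1 ∧ x = (L, j) ∧ y = (L + 1, j)) ∨
      (x = (L, i) ∧ y = (L + 1, i + 1)) ∨ (x = (L, i + 1) ∧ y = (L + 1, i))

theorem Segment.of_append {u : List Piece} {p : Piece} {x y : ℕ × ℕ}
    (h : Segment (u ++ [p]) x y) :
    (Segment u x y ∧ x.1 ≤ u.length ∧ y.1 ≤ u.length) ∨ LocalSegment u.length p x y := by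
  cases h with
  | cupLeft h hj =>
    rcases getElem?_append_singleton_eq_some h with ⟨hk, h⟩ | ⟨rfl, rfl⟩
    · exact .inl ⟨.cupLeft h hj, hk.le, hk⟩
    · exact .inr (.inl ⟨_, hj, rfl, rfl⟩)
  | cupRight h hj =>
    rcases getElem?_append_singleton_eq_some h with ⟨hk, h⟩ | ⟨rfl, rfl⟩
    · exact .inl ⟨.cupRight h hj, hk.le, hk⟩
    · exact .inr (.inr (.inl ⟨_, hj, rfl, rfl⟩))
  | cupArc h =>
    rcases getElem?_append_singleton_eq_some h with ⟨hk, h⟩ | ⟨rfl, rfl⟩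
    · exact .inl ⟨.cupArc h, hk, hk⟩
    · exact .inr (.inr (.inr ⟨rfl, rfl⟩))
  | capLeft h hj =>
    rcases getElem?_append_singleton_eq_some h with ⟨hk, h⟩ | ⟨rfl, rfl⟩
    · exact .inl ⟨.capLeft h hj, hk.le, hk⟩
    · exact .inr (.inl ⟨_, hj, rfl, rfl⟩)
  | capRight h hj =>
    rcases getElem?_append_singleton_eq_some h with ⟨hk, h⟩ | ⟨rfl, rfl⟩
    · exact .inl ⟨.capRight h hj, hk.le, hk⟩
    · exact .inr (.inr (.inl ⟨_, hj, rfl, rfl⟩))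
  | capArc h =>
    rcases getElem?_append_singleton_eq_some h with ⟨hk, h⟩ | ⟨rfl, rfl⟩
    · exact .inl ⟨.capArc h, hk.le, hk.le⟩
    · exact .inr (.inr (.inr ⟨rfl, rfl⟩))
  | virtSide h h₀ h₁ =>
    rcases getElem?_append_singleton_eq_some h with ⟨hk, h⟩ | ⟨rfl, rfl⟩
    · exact .inl ⟨.virtSide h h₀ h₁, hk.le, hk⟩
    · exact .inr (.inl ⟨_, h₀, h₁, rfl, rfl⟩)
  | virtRight h =>
    rcases getElem?_append_singleton_eq_some h with ⟨hk, h⟩ | ⟨rfl, rfl⟩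
    · exact .inl ⟨.virtRight h, hk.le, hk⟩
    · exact .inr (.inr (.inl ⟨rfl, rfl⟩))
  | virtLeft h =>
    rcases getElem?_append_singleton_eq_some h with ⟨hk, h⟩ | ⟨rfl, rfl⟩
    · exact .inl ⟨.virtLeft h, hk.le, hk⟩
    · exact .inr (.inr (.inr ⟨rfl, rfl⟩))

theorem LocalSegment.segment {u : List Piece} {p : Piece} {x y : ℕ × ℕ}
    (h : LocalSegment u.length p x y) : Segment (u ++ [p]) x y := by
  have hp : (u ++ [p])[u.length]? = some p := by simp
  cases p with
  | cup i =>
    rcases h with ⟨j, hj, rfl, rfl⟩ | ⟨j, hj, rfl, rfl⟩ | ⟨rfl, rfl⟩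
    exacts [.cupLeft hp hj, .cupRight hp hj, .cupArc hp]
  | cap i =>
    rcases h with ⟨j, hj, rfl, rfl⟩ | ⟨j, hj, rfl, rfl⟩ | ⟨rfl, rfl⟩
    exacts [.capLeft hp hj, .capRight hp hj, .capArc hp]
  | virt i =>
    rcases h with ⟨j, h₀, h₁, rfl, rfl⟩ | ⟨rfl, rfl⟩ | ⟨rfl, rfl⟩
    exacts [.virtSide hp h₀ h₁, .virtRight hp, .virtLeft hp]

/-- Extends `f` to the level `L + 1` by the labels `g`. -/
def extendRoot (L : ℕ) (f : ℕ × ℕ → ℕ × ℕ) (g : ℕ → ℕ × ℕ) (x : ℕ × ℕ) : ℕ × ℕ :=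
  if x.1 = L + 1 then g x.2 else f x

@[simp]
theorem extendRoot_new (L : ℕ) (f : ℕ × ℕ → ℕ × ℕ) (g : ℕ → ℕ × ℕ) (j : ℕ) :
    extendRoot L f g (L + 1, j) = g j := if_pos rfl

@[simp]
theorem extendRoot_top (L : ℕ) (f : ℕ × ℕ → ℕ × ℕ) (g : ℕ → ℕ × ℕ) (j : ℕ) :
    extendRoot L f g (L, j) = f (L, j) := if_neg (by simp)

theorem extendRoot_old {L : ℕ} {x : ℕ × ℕ} (f : ℕ × ℕ → ℕ × ℕ) (g : ℕ → ℕ × ℕ) (h : x.1 ≤ L) :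
    extendRoot L f g x = f x := if_neg (by omega)

/-- Extending a root map over one more piece: it suffices to look at the new piece. -/
theorem RootMap.extend {u : List Piece} {p : Piece} {f : ℕ × ℕ → ℕ × ℕ} {s : Finset (ℕ × ℕ)}
    {g : ℕ → ℕ × ℕ}
    (seg : ∀ {x y}, Joined u x y → f x = f y)
    (conn : ∀ {x}, Valid u x → Relation.EqvGen (Joined (u ++ [p])) x (f x))
    (mem : ∀ {x}, Valid u x → f x ∈ s)
    (root : ∀ {c}, c ∈ s → Valid (u ++ [p]) c ∧ extendRoot u.length f g c = c)
    (seg' : ∀ {x y}, Valid (u ++ [p]) x → Valid (u ++ [p]) y → LocalSegment u.length p x y →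
      extendRoot u.length f g x = extendRoot u.length f g y)
    (conn' : ∀ {j}, j < p.width (widthAt u u.length) →
      Relation.EqvGen (Joined (u ++ [p])) (u.length + 1, j) (g j))
    (mem' : ∀ {j}, j < p.width (widthAt u u.length) → g j ∈ s) :
    RootMap (u ++ [p]) (extendRoot u.length f g) s where
  seg := by
    rintro x y ⟨hx, hy, h⟩
    rcases h.of_append with ⟨h, hx', hy'⟩ | h
    · rw [extendRoot_old _ _ hx', extendRoot_old _ _ hy']
      refine seg ⟨(valid_append.1 hx).resolve_right (by omega),
        (valid_append.1 hy).resolve_right (by omega), h⟩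
    · exact seg' hx hy h
  conn := by
    intro x hx
    rcases valid_append.1 hx with hx | ⟨hx, hj⟩
    · rw [extendRoot_old _ _ hx.1]
      exact conn hx
    · obtain ⟨k, j⟩ := x
      obtain rfl : k = _ := hx
      rw [extendRoot_new]
      exact conn' hj
  mem := by
    intro x hx
    rcases valid_append.1 hx with hx | ⟨hx, hj⟩
    · rw [extendRoot_old _ _ hx.1]
      exact mem hx
    · obtain ⟨k, j⟩ := x
      obtain rfl : k = _ := hx
      rw [extendRoot_new]
      exact mem' hj
  root := root

/-! ### Pairings of the top strands as normalized lists of labels. -/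

/-- The labels `h 0, …, h (n - 1)`, each replaced by the first position where it occurs. -/
def pattern (n : ℕ) (h : ℕ → ℕ) : List ℕ :=
  (List.range n).map fun j => ((List.range n).map h).idxOf (h j)

@[simp]
theorem length_pattern (n : ℕ) (h : ℕ → ℕ) : (pattern n h).length = n := by simp [pattern]

/-- Normalizing keeps exactly the information which labels agree. Equal pairings thus become equal
lists, which `decide` can compare later. -/
theorem getD_pattern_eq_iff {n : ℕ} {h : ℕ → ℕ} {i j : ℕ} (hi : i < n) (hj : j < n) :
    (pattern n h).getD i 0 = (pattern n h).getD j 0 ↔ h i = h j := by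
  have key {k : ℕ} (hk : k < n) :
      (pattern n h).getD k 0 = ((List.range n).map h).idxOf (h k) := by
    simp [pattern, hk]
  rw [key hi, key hj, List.idxOf_inj (List.mem_map_of_mem (List.mem_range.2 hi))]

/-- The labels of the strands above a piece, given the labels `m` of the strands below it; strands
of one component carry the same label. -/
def Piece.act : Piece → List ℕ → List ℕ
  | .cup i, m => pattern (m.length + 2) fun j =>
      if j < i then m.getD j 0 else if j < i + 2 then m.sum + 1 else m.getD (j - 2) 0
  | .cap i, m => pattern (m.length - 2) fun j =>
      if m.getD (if j < i then j else j + 2) 0 = m.getD i 0 then m.getD (i + 1) 0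
      else m.getD (if j < i then j else j + 2) 0
  | .virt i, m => pattern m.length fun j =>
      m.getD (if j = i then i + 1 else if j = i + 1 then i else j) 0

/-- The number of curves closed up by a piece. -/
def Piece.loops : Piece → List ℕ → ℕ
  | .cap i, m => if m.getD i 0 = m.getD (i + 1) 0 then 1 else 0
  | _, _ => 0

theorem Piece.length_act (p : Piece) (m : List ℕ) : (p.act m).length = p.width m.length := by
  cases p <;> simp [Piece.act, Piece.width]

/-- The strands at the top of `u` are labelled by `m` according to their components, and `l` curves
are closed. -/
def Tracks (u : List Piece) (m : List ℕ) (l : ℕ) : Prop :=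
  ∃ f s, RootMap u f s ∧ 2 * s.card = 2 * l + m.length ∧ widthAt u u.length = m.length ∧
    ∀ i < m.length, ∀ j < m.length,
      (f (u.length, i) = f (u.length, j) ↔ m.getD i 0 = m.getD j 0)

theorem tracks_nil : Tracks [] [] 0 := by
  refine ⟨id, ∅, ⟨?_, ?_, ?_, ?_⟩, rfl, rfl, by simp⟩
  · rintro x y ⟨-, -, h⟩
    cases h <;> simp_all
  · exact fun _ => .refl _
  · rintro x ⟨h, h'⟩
    simp [widthAt] at h'
  · simp

theorem Tracks.curves_eq {u : List Piece} {l : ℕ} (h : Tracks u [] l) : curves u = l := by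
  obtain ⟨f, s, hf, hs, -⟩ := h
  rw [hf.curves_eq]
  simpa using hs

/-! ### Effect of a minimum, a virtual crossing and a maximum on representatives. -/

section

variable {u : List Piece} {f : ℕ × ℕ → ℕ × ℕ} {s : Finset (ℕ × ℕ)}

theorem RootMap.conn_append (hf : RootMap u f s) (p : Piece) {x : ℕ × ℕ} (hx : Valid u x) :
    EqvGen (Joined (u ++ [p])) x (f x) :=
  (hf.conn hx).mono fun _ _ h => h.append p

theorem eqvGen_of_localSegment {p : Piece} {x y : ℕ × ℕ} (hx : Valid (u ++ [p]) x)
    (hy : Valid (u ++ [p]) y) (h : LocalSegment u.length p x y) : EqvGen (Joined (u ++ [p])) x y :=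
  .rel _ _ ⟨hx, hy, h.segment⟩

theorem valid_top {j : ℕ} (hj : j < widthAt u u.length) : Valid u (u.length, j) :=
  ⟨le_rfl, hj⟩

theorem valid_append_old {x : ℕ × ℕ} (p : Piece) (hx : Valid u x) : Valid (u ++ [p]) x :=
  valid_append.2 (.inl hx)

theorem valid_append_new {p : Piece} {j : ℕ} (hj : j < p.width (widthAt u u.length)) :
    Valid (u ++ [p]) (u.length + 1, j) :=
  valid_append.2 (.inr ⟨rfl, hj⟩)

/-- The new arc is a component of its own, represented by its left end. -/
theorem RootMap.cup (hf : RootMap u f s) {i : ℕ} (hi : i ≤ widthAt u u.length) :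
    RootMap (u ++ [.cup i])
      (extendRoot u.length f fun j => if j < i then f (u.length, j) else
        if j < i + 2 then (u.length + 1, i) else f (u.length, j - 2))
      (insert (u.length + 1, i) s) := by
  refine RootMap.extend hf.seg (hf.conn_append _) (fun hx => Finset.mem_insert_of_mem (hf.mem hx))
    ?_ ?_ ?_ ?_
  · intro c hc
    rcases Finset.mem_insert.1 hc with rfl | hc
    · exact ⟨valid_append_new (by simp [Piece.width]; omega), by simp⟩
    · obtain ⟨hv, h⟩ := hf.root hc
      exact ⟨valid_append_old _ hv, by rw [extendRoot_old _ _ hv.1, h]⟩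
  · intro x y hx hy h
    rcases h with ⟨j, hj, rfl, rfl⟩ | ⟨j, hj, rfl, rfl⟩ | ⟨rfl, rfl⟩
    · rw [extendRoot_top, extendRoot_new, if_pos hj]
    · rw [extendRoot_top, extendRoot_new, if_neg (by omega), if_neg (by omega),
        Nat.add_sub_cancel]
    · simp
  · intro j hj
    have hv := valid_append_new hj
    simp only [Piece.width] at hj
    split_ifs with h₁ h₂
    · have ht := valid_top (u := u) (j := j) (by omega)
      exact (eqvGen_of_localSegment (valid_append_old _ ht) hv
        (Or.inl ⟨j, h₁, rfl, rfl⟩)).symm.trans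
        _ _ _ (hf.conn_append _ ht)
    · obtain rfl | rfl : j = i ∨ j = i + 1 := by omega
      · exact .refl _
      · exact (eqvGen_of_localSegment (valid_append_new (by simp [Piece.width]; omega)) hv
        (Or.inr (Or.inr ⟨rfl, rfl⟩))).symm
    · have ht := valid_top (u := u) (j := j - 2) (by omega)
      exact (eqvGen_of_localSegment (valid_append_old _ ht) hv
        (Or.inr (Or.inl ⟨j - 2, by omega, rfl, by
        rw [Nat.sub_add_cancel (by omega)]⟩))).symm.trans
        _ _ _ (hf.conn_append _ ht)
  · intro j hj
    simp only [Piece.width] at hj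
    split_ifs with h₁ h₂
    · exact Finset.mem_insert_of_mem (hf.mem (valid_top (by omega)))
    · exact Finset.mem_insert_self _ _
    · exact Finset.mem_insert_of_mem (hf.mem (valid_top (by omega)))

theorem RootMap.virt (hf : RootMap u f s) {i : ℕ} (hi : i + 2 ≤ widthAt u u.length) :
    RootMap (u ++ [.virt i])
      (extendRoot u.length f fun j =>
        f (u.length, if j = i then i + 1 else if j = i + 1 then i else j)) s := by
  refine RootMap.extend hf.seg (hf.conn_append _) hf.mem ?_ ?_ ?_ ?_
  · intro c hc
    obtain ⟨hv, h⟩ := hf.root hc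
    exact ⟨valid_append_old _ hv, by rw [extendRoot_old _ _ hv.1, h]⟩
  · intro x y hx hy h
    rcases h with ⟨j, h₀, h₁, rfl, rfl⟩ | ⟨rfl, rfl⟩ | ⟨rfl, rfl⟩
    · rw [extendRoot_top, extendRoot_new, if_neg h₀, if_neg h₁]
    · rw [extendRoot_top, extendRoot_new, if_neg (by omega), if_pos rfl]
    · rw [extendRoot_top, extendRoot_new, if_pos rfl]
  · intro j hj
    have hv := valid_append_new hj
    simp only [Piece.width] at hj
    split_ifs with h₁ h₂
    · subst h₁
      have ht := valid_top (u := u) (j := j + 1) (by omega)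
      exact (eqvGen_of_localSegment (valid_append_old _ ht) hv
        (Or.inr (Or.inr ⟨rfl, rfl⟩))).symm.trans
        _ _ _ (hf.conn_append _ ht)
    · subst h₂
      have ht := valid_top (u := u) (j := i) (by omega)
      exact (eqvGen_of_localSegment (valid_append_old _ ht) hv
        (Or.inr (Or.inl ⟨rfl, rfl⟩))).symm.trans
        _ _ _ (hf.conn_append _ ht)
    · have ht := valid_top hj
      exact (eqvGen_of_localSegment (valid_append_old _ ht) hv
        (Or.inl ⟨j, h₁, h₂, rfl, rfl⟩)).symm.trans _ _ _ (hf.conn_append _ ht)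
  · intro j hj
    simp only [Piece.width] at hj
    exact hf.mem (valid_top (by split_ifs <;> omega))

/-- The component of strand `i` is merged into that of strand `i + 1` by redirecting its
representative. If both are already the same component, the insertion undoes the erasure, so one
formula covers both cases. -/
theorem RootMap.cap (hf : RootMap u f s) {i : ℕ} (hi : i + 2 ≤ widthAt u u.length)
    {f' : ℕ × ℕ → ℕ × ℕ} (hf' : ∀ x, f' x =
      if f x = f (u.length, i) then f (u.length, i + 1) else f x) :
    RootMap (u ++ [.cap i])
      (extendRoot u.length f' fun j => f' (u.length, if j < i then j else j + 2))
      (insert (f (u.length, i + 1)) (s.erase (f (u.length, i)))) := by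
  have h₀ : Valid u (u.length, i) := valid_top (by omega)
  have h₁ : Valid u (u.length, i + 1) := valid_top (by omega)
  have conn {x : ℕ × ℕ} (hx : Valid u x) : EqvGen (Joined (u ++ [.cap i])) x (f' x) := by
    rw [hf']
    split_ifs with h
    · have hc := hf.conn_append (.cap i) hx
      rw [h] at hc
      exact ((hc.trans _ _ _ (hf.conn_append _ h₀).symm).trans _ _ _
        (eqvGen_of_localSegment (valid_append_old _ h₀) (valid_append_old _ h₁)
        (Or.inr (Or.inr ⟨rfl, rfl⟩)))).trans
        _ _ _ (hf.conn_append _ h₁)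
    · exact hf.conn_append _ hx
  have mem {x : ℕ × ℕ} (hx : Valid u x) :
      f' x ∈ insert (f (u.length, i + 1)) (s.erase (f (u.length, i))) := by
    rw [hf']
    split_ifs with h
    · exact Finset.mem_insert_self _ _
    · exact Finset.mem_insert_of_mem (Finset.mem_erase.2 ⟨h, hf.mem hx⟩)
  refine RootMap.extend ?_ conn mem ?_ ?_ ?_ ?_
  · intro x y h
    rw [hf', hf', hf.seg h]
  · intro c hc
    have hc' : c = f (u.length, i + 1) ∨ c ≠ f (u.length, i) ∧ c ∈ s := by simpa using hc
    have hcs : c ∈ s := by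
      rcases hc' with rfl | hc'
      exacts [hf.mem h₁, hc'.2]
    obtain ⟨hv, h⟩ := hf.root hcs
    refine ⟨valid_append_old _ hv, ?_⟩
    rw [extendRoot_old _ _ hv.1, hf', h]
    split_ifs with hci
    · rcases hc' with hc' | hc'
      exacts [hc'.symm, absurd hci hc'.1]
    · rfl
  · intro x y hx hy h
    rcases h with ⟨j, hj, rfl, rfl⟩ | ⟨j, hj, rfl, rfl⟩ | ⟨rfl, rfl⟩
    · rw [extendRoot_top, extendRoot_new, if_pos hj]
    · rw [extendRoot_top, extendRoot_new, if_neg (by omega)]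
    · rw [extendRoot_top, extendRoot_top, hf', hf', if_pos rfl]
      split_ifs <;> rfl
  · intro j hj
    have hv := valid_append_new hj
    simp only [Piece.width] at hj
    split_ifs with h
    · have ht := valid_top (u := u) (j := j) (by omega)
      exact (eqvGen_of_localSegment (valid_append_old _ ht) hv
        (Or.inl ⟨j, h, rfl, rfl⟩)).symm.trans
        _ _ _ (conn ht)
    · have ht := valid_top (u := u) (j := j + 2) (by omega)
      exact (eqvGen_of_localSegment (valid_append_old _ ht) hv
        (Or.inr (Or.inl ⟨j, by omega, rfl, rfl⟩))).symm.trans _ _ _ (conn ht)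
  · intro j hj
    simp only [Piece.width] at hj
    exact mem (valid_top (by split_ifs <;> omega))

end

/-- This makes `m.sum + 1`, the label a minimum gives to its strands, a fresh one. -/
theorem getD_le_sum (m : List ℕ) (j : ℕ) : m.getD j 0 ≤ m.sum := by
  by_cases hj : j < m.length
  · rw [List.getD_eq_getElem _ _ hj]
    exact List.le_sum_of_mem (List.getElem_mem hj)
  · rw [List.getD_eq_default _ _ (not_lt.1 hj)]
    exact Nat.zero_le _

/-- Every open component has two ends at the top, so twice the number of components is `2 * l +
m.length`. A minimum adds a component and two ends; a maximum removes two ends and either closes a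
curve, keeping the number of components, or merges two of them. -/
theorem Tracks.append {u : List Piece} {m : List ℕ} {l : ℕ} (h : Tracks u m l) (p : Piece)
    (hp : p.Fits m.length) : Tracks (u ++ [p]) (p.act m) (l + p.loops m) := by
  obtain ⟨f, s, hf, hs, hw, hm⟩ := h
  have hw' : widthAt (u ++ [p]) (u ++ [p]).length = (p.act m).length := by
    rw [List.length_append, List.length_singleton, widthAt_append_length, hw, p.length_act]
  have valid {j : ℕ} (hj : j < m.length) : Valid u (u.length, j) := valid_top (hw ▸ hj)
  -- Old representatives are points of `u`, hence lie at level `u.length` or below.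
  have ne_new {j : ℕ} (hj : j < m.length) (i : ℕ) : f (u.length, j) ≠ (u.length + 1, i) := by
    intro h
    have := (hf.root (hf.mem (valid hj))).1.1
    rw [h] at this
    simp at this
  cases p with
  | cup i =>
    simp only [Piece.Fits] at hp
    refine ⟨_, _, hf.cup (hw ▸ hp), ?_, hw', ?_⟩
    · rw [Finset.card_insert_of_notMem]
      · simp only [Piece.act, length_pattern, Piece.loops]
        omega
      · intro h
        have := (hf.root h).1.1
        simp at this
    · intro a ha b hb
      simp only [Piece.act, length_pattern] at ha hb ⊢
      rw [getD_pattern_eq_iff ha hb, List.length_append, List.length_singleton, extendRoot_new,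
        extendRoot_new]
      have ne_sum (j : ℕ) : m.getD j 0 ≠ m.sum + 1 := by
        have := getD_le_sum m j
        omega
      have key {a b : ℕ} (ha : a < m.length) (hb : b < m.length) := hm a ha b hb
      split_ifs
      · exact key (by omega) (by omega)
      · exact iff_of_false (ne_new (by omega) _) (ne_sum _)
      · exact key (by omega) (by omega)
      · exact iff_of_false (ne_new (by omega) _).symm (ne_sum _).symm
      · simp
      · exact iff_of_false (ne_new (by omega) _).symm (ne_sum _).symm
      · exact key (by omega) (by omega)
      · exact iff_of_false (ne_new (by omega) _) (ne_sum _)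
      · exact key (by omega) (by omega)
  | cap i =>
    simp only [Piece.Fits] at hp
    refine ⟨_, _, hf.cap (hw ▸ hp) fun _ => rfl, ?_, hw', ?_⟩
    · simp only [Piece.act, length_pattern, Piece.loops]
      have hi := hm i (by omega) (i + 1) (by omega)
      have h₀ := hf.mem (valid (show i < m.length by omega))
      have h₁ := hf.mem (valid (show i + 1 < m.length by omega))
      have hpos := Finset.card_pos.2 ⟨_, h₀⟩
      by_cases h : f (u.length, i) = f (u.length, i + 1)
      · rw [if_pos (hi.1 h), ← h, Finset.insert_erase h₀]
        omega
      · rw [if_neg (mt hi.2 h), Finset.insert_eq_of_mem (Finset.mem_erase.2 ⟨Ne.symm h, h₁⟩),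
          Finset.card_erase_of_mem h₀]
        omega
    · intro a ha b hb
      simp only [Piece.act, length_pattern] at ha hb ⊢
      rw [getD_pattern_eq_iff ha hb, List.length_append, List.length_singleton, extendRoot_new,
        extendRoot_new]
      have ha' : (if a < i then a else a + 2) < m.length := by split_ifs <;> omega
      have hb' : (if b < i then b else b + 2) < m.length := by split_ifs <;> omega
      generalize (if a < i then a else a + 2) = a at ha'
      generalize (if b < i then b else b + 2) = b at hb'
      have h₀ : i < m.length := by omega
      have h₁ : i + 1 < m.length := by omega
      simp only [hm a ha' i h₀, hm b hb' i h₀]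
      split_ifs
      · simp
      · exact hm _ h₁ _ hb'
      · exact hm _ ha' _ h₁
      · exact hm _ ha' _ hb'
  | virt i =>
    simp only [Piece.Fits] at hp
    refine ⟨_, _, hf.virt (hw ▸ hp), ?_, hw', ?_⟩
    · simpa only [Piece.act, length_pattern, Piece.loops, add_zero] using hs
    · intro a ha b hb
      simp only [Piece.act, length_pattern] at ha hb ⊢
      rw [getD_pattern_eq_iff ha hb, List.length_append, List.length_singleton, extendRoot_new,
        extendRoot_new]
      exact hm _ (by split_ifs <;> omega) _ (by split_ifs <;> omega)

/-! ### The state sum as a recursion over the pieces. -/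

/-- The exponent contributed by a smoothing. -/
def Smoothing.sign : Smoothing → ℤ
  | .alpha => 1
  | .beta => -1

theorem Smoothing.sum_univ {M : Type*} [AddCommMonoid M] (g : Smoothing → M) :
    ∑ a, g a = g .alpha + g .beta := by
  rw [show (Finset.univ : Finset Smoothing) = {.alpha, .beta} from rfl,
    Finset.sum_pair (by decide)]

theorem Diagram.State.c_eq_sum {D : Diagram} (s : D.State) : s.c = ∑ k, (s k).sign := by
  rw [Diagram.State.c, Finset.card_filter, Finset.card_filter]
  push_cast
  rw [← Finset.sum_sub_distrib]
  refine Finset.sum_congr rfl fun k _ => ?_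
  cases s k <;> simp [Smoothing.sign]

/-- The state sum of the upper part `w` of a diagram over strands labelled by `m`. -/
noncomputable def value : List Slice → List ℕ → LaurentPolynomial ℤ
  | [], _ => 1
  | .plain p :: w, m => d ^ p.loops m * value w (p.act m)
  | .over i :: w, m => T 1 * value w m +
      T (-1) * (d ^ (Piece.cap i).loops m * value w ((Piece.cup i).act ((Piece.cap i).act m)))
  | .under i :: w, m => T (-1) * value w m +
      T 1 * (d ^ (Piece.cap i).loops m * value w ((Piece.cup i).act ((Piece.cap i).act m)))

theorem Tracks.cap_cup {u : List Piece} {m : List ℕ} {l i : ℕ} (h : Tracks u m l)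
    (hi : i + 2 ≤ m.length) :
    Tracks (u ++ [.cap i, .cup i]) ((Piece.cup i).act ((Piece.cap i).act m))
      (l + (Piece.cap i).loops m) := by
  have h' := (h.append (.cap i) hi).append (.cup i)
    (by simp only [Piece.Fits, Piece.length_act, Piece.width]; omega)
  simpa [Piece.loops] using h'

/-- The sum over states is split according to the smoothing of the lowest crossing, numbered `0`. -/
theorem sum_states_succ {n : ℕ}
    (F : Smoothing → (Fin n → Smoothing) → LaurentPolynomial ℤ) :
    ∑ s : Fin (n + 1) → Smoothing, T (∑ k, (s k).sign) * F (s 0) (fun k => s k.succ) =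
      T 1 * ∑ s : Fin n → Smoothing, T (∑ k, (s k).sign) * F .alpha s +
      T (-1) * ∑ s : Fin n → Smoothing, T (∑ k, (s k).sign) * F .beta s := by
  rw [← (Fin.consEquiv fun _ : Fin (n + 1) => Smoothing).sum_comp, Fintype.sum_prod_type,
    Smoothing.sum_univ]
  simp [Fin.consEquiv, Fin.sum_univ_succ, T_add, -T_mul, Smoothing.sign, Finset.mul_sum, mul_assoc]

/-- Induction on the unsmoothed part `w`, with the part `u` below it already smoothed. Using the
exponent `curves` rather than `curves - 1` makes closed curves contribute multiplicatively. -/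
theorem sum_states_eq_value (w : List Slice) {u : List Piece} {m : List ℕ} {l : ℕ}
    (h : Tracks u m l) (hw : ClosesFrom m.length w) :
    ∑ s : Fin (crossings w) → Smoothing, T (∑ k, (s k).sign) * d ^ curves (u ++ smooth w s) =
      d ^ l * value w m := by
  induction w generalizing u m l with
  | nil =>
    obtain rfl : m = [] := List.length_eq_zero_iff.1 hw
    change ∑ s : Fin 0 → Smoothing, T (∑ k : Fin 0, (s k).sign) * d ^ curves (u ++ []) = _
    simp [value, h.curves_eq]
  | cons a w ih =>
    rcases a with p | i | i
    · obtain ⟨hp, hw⟩ := hw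
      have := ih (h.append p hp) (by rwa [p.length_act])
      simp only [List.append_assoc, List.singleton_append] at this
      refine this.trans ?_
      rw [pow_add, mul_assoc]
      rfl
    · obtain ⟨hi, hw⟩ := hw
      have h₁ := ih h hw
      have h₂ := ih (h.cap_cup hi) (by
        simp only [Piece.length_act, Piece.width]
        rwa [Nat.sub_add_cancel (by omega)])
      refine (sum_states_succ fun a s =>
        d ^ curves (u ++ (smoothOver i a ++ smooth w s))).trans ?_
      simp only [smoothOver, List.nil_append, ← List.append_assoc, h₁, h₂, value]
      ring
    · obtain ⟨hi, hw⟩ := hw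
      have h₁ := ih h hw
      have h₂ := ih (h.cap_cup hi) (by
        simp only [Piece.length_act, Piece.width]
        rwa [Nat.sub_add_cancel (by omega)])
      refine (sum_states_succ fun a s =>
        d ^ curves (u ++ (smoothUnder i a ++ smooth w s))).trans ?_
      simp only [smoothUnder, List.nil_append, ← List.append_assoc, h₁, h₂, value]
      ring

/-! ### Passing between the recursion and the bracket. -/

instance (w : List Piece) : Finite (Point w) :=
  Finite.of_injective
    (fun x : Point w => (⟨⟨x.1.1, Nat.lt_succ_of_le x.2.1⟩, ⟨x.1.2, x.2.2⟩⟩ :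
      Σ k : Fin (w.length + 1), Fin (widthAt w k))) (by
    rintro ⟨⟨a, b⟩, ha⟩ ⟨⟨a', b'⟩, ha'⟩ h
    simp only [Sigma.mk.injEq, Fin.mk.injEq] at h
    obtain ⟨rfl, h⟩ := h
    simp only [heq_eq_eq, Fin.mk.injEq] at h
    subst h
    rfl)

/-- Finiteness of the set of points matters here, since `Nat.card` of an infinite type is `0`. -/
theorem curves_pos (i : ℕ) (w : List Piece) : 0 < curves (.cup i :: w) := by
  have : Nonempty (Point (.cup i :: w)) := ⟨⟨(1, 0), by simp [widthAt, Piece.width]⟩⟩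
  have : Nonempty (Quot fun x y : Point (.cup i :: w) => Segment (.cup i :: w) x.1 y.1) :=
    this.map (Quot.mk _)
  exact Nat.card_pos

/-- The initial minimum guarantees at least one curve in every state, so the factor d turns the
truncated exponent `curves - 1` into `curves`. -/
theorem d_mul_bracket (D : Diagram) {i : ℕ} {w : List Slice} (hD : D.word = .plain (.cup i) :: w) :
    d * D.bracket = value D.word [] := by
  rw [← one_mul (value _ _), ← pow_zero d, ← sum_states_eq_value D.word tracks_nil D.closed,
    Diagram.bracket, Finset.mul_sum]
  refine Finset.sum_congr rfl fun s _ => ?_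
  have hpos : 0 < curves (smooth D.word s) := by
    clear * - hD
    -- The type of `s` depends on `D.word`, so `s` has to be generalized before rewriting with `hD`.
    revert s
    unfold Diagram.State
    rw [hD]
    exact fun s => curves_pos _ _
  rw [Diagram.State.c_eq_sum, List.nil_append, mul_left_comm, mul_pow_sub_one hpos.ne']

theorem d_ne_zero : d ≠ 0 := by
  intro h
  -- At A = 1 the value of d is -2.
  have := congrArg (fun p => LaurentPolynomial.eval₂ (RingHom.id ℤ) 1 p) h
  simp [d] at this

theorem bracket_eq_one (D : Diagram) {i : ℕ} {w : List Slice}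
    (hD : D.word = .plain (.cup i) :: w) (h : value D.word [] = d) : D.bracket = 1 := by
  rw [← d_mul_bracket D hD] at h
  exact mul_left_cancel₀ d_ne_zero (h.trans (mul_one d).symm)

theorem bracket_unknot : unknot.bracket = 1 := by
  refine bracket_eq_one _ rfl ?_
  simp [unknot, value, Piece.act, Piece.loops, pattern]

/-! ### Twists acting by powers of -A^{∓3}. -/

theorem T_mul_T_neg : (T 1 : LaurentPolynomial ℤ) * T (-1) = 1 := by
  rw [← T_add, add_neg_cancel, T_zero]

theorem d_eq : d = -T (-1) ^ 2 - T 1 ^ 2 := by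
  simp [d, T_pow]

/-- The crossing is a kink in the arc joining strands `0` and `1`: both smoothings restore the
pairing, one with an extra curve, and A + A⁻¹d = -A⁻³. -/
theorem value_over_zero_parallel (w : List Slice) :
    value (.over 0 :: w) [0, 0, 2, 2] = -T (-1) ^ 3 * value w [0, 0, 2, 2] := by
  have ha : (Piece.cup 0).act ((Piece.cap 0).act [0, 0, 2, 2]) = [0, 0, 2, 2] := by decide
  have hl : (Piece.cap 0).loops [0, 0, 2, 2] = 1 := by decide
  simp only [value, ha, hl, pow_one, d_eq]
  linear_combination (-T 1 * value w [0, 0, 2, 2]) * T_mul_T_neg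

theorem value_under_zero_parallel (w : List Slice) :
    value (.under 0 :: w) [0, 0, 2, 2] = -T 1 ^ 3 * value w [0, 0, 2, 2] := by
  have ha : (Piece.cup 0).act ((Piece.cap 0).act [0, 0, 2, 2]) = [0, 0, 2, 2] := by decide
  have hl : (Piece.cap 0).loops [0, 0, 2, 2] = 1 := by decide
  simp only [value, ha, hl, pow_one, d_eq]
  linear_combination (-T (-1) * value w [0, 0, 2, 2]) * T_mul_T_neg

/-- The factor by which `t` half twists of the strands `0` and `1` act. -/
noncomputable def twistFactor (t : ℤ) : LaurentPolynomial ℤ :=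
  (if 0 ≤ t then -T (-1) ^ 3 else -T 1 ^ 3) ^ t.natAbs

theorem twistFactor_mul_neg (t : ℤ) : twistFactor t * twistFactor (-t) = 1 := by
  have h : (-T (-1) ^ 3 : LaurentPolynomial ℤ) * -T 1 ^ 3 = 1 := by
    rw [neg_mul_neg, ← mul_pow, mul_comm, T_mul_T_neg, one_pow]
  rcases lt_trichotomy t 0 with ht | rfl | ht
  · rw [twistFactor, twistFactor, if_neg (by omega), if_pos (by omega), Int.natAbs_neg, ← mul_pow,
      mul_comm, h, one_pow]
  · simp [twistFactor]
  · rw [twistFactor, twistFactor, if_pos (by omega), if_neg (by omega), Int.natAbs_neg, ← mul_pow,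
      h, one_pow]

/-- The crossing is not a kink here, but the smoothing with a maximum yields the parallel pairing,
and `hw` supplies the factor d that the closed curve of a kink would give. -/
theorem value_over_zero_crossed {w : List Slice}
    (hw : value w [0, 0, 2, 2] = d * value w [0, 1, 0, 1]) :
    value (.over 0 :: w) [0, 1, 0, 1] = -T (-1) ^ 3 * value w [0, 1, 0, 1] := by
  have ha : (Piece.cup 0).act ((Piece.cap 0).act [0, 1, 0, 1]) = [0, 0, 2, 2] := by decide
  have hl : (Piece.cap 0).loops [0, 1, 0, 1] = 0 := by decide
  simp only [value, ha, hl, pow_zero, hw, d_eq]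
  linear_combination (-T 1 * value w [0, 1, 0, 1]) * T_mul_T_neg

theorem value_under_zero_crossed {w : List Slice}
    (hw : value w [0, 0, 2, 2] = d * value w [0, 1, 0, 1]) :
    value (.under 0 :: w) [0, 1, 0, 1] = -T 1 ^ 3 * value w [0, 1, 0, 1] := by
  have ha : (Piece.cup 0).act ((Piece.cap 0).act [0, 1, 0, 1]) = [0, 0, 2, 2] := by decide
  have hl : (Piece.cap 0).loops [0, 1, 0, 1] = 0 := by decide
  simp only [value, ha, hl, pow_zero, hw, d_eq]
  linear_combination (-T (-1) * value w [0, 1, 0, 1]) * T_mul_T_neg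

theorem value_twist_parallel (t : ℤ) (w : List Slice) :
    value (twist t ++ w) [0, 0, 2, 2] = twistFactor t * value w [0, 0, 2, 2] := by
  unfold twist twistFactor
  generalize t.natAbs = n
  induction n with
  | zero => simp
  | succ n ih =>
    rw [List.replicate_succ, List.cons_append, pow_succ', mul_assoc, ← ih]
    split_ifs
    · exact value_over_zero_parallel _
    · exact value_under_zero_parallel _

/-- If the upper part `w` does not distinguish the crossed strands from the parallel ones, except
for a factor `d`, then twists act on it by a factor. -/
theorem value_twist_crossed (t : ℤ) {w : List Slice}
    (hw : value w [0, 0, 2, 2] = d * value w [0, 1, 0, 1]) :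
    value (twist t ++ w) [0, 1, 0, 1] = twistFactor t * value w [0, 1, 0, 1] := by
  unfold twist twistFactor
  generalize t.natAbs = n
  induction n generalizing w with
  | zero => simp
  | succ n ih =>
    -- The twist next to `w` is split off and absorbed into `w`. The hypothesis `hw` survives, since
    -- a twist multiplies the parallel and the crossed value by the same factor.
    rw [List.replicate_succ', List.append_assoc, List.singleton_append, pow_succ, mul_assoc]
    split_ifs at ih ⊢
    · have h := value_over_zero_crossed hw
      rw [ih (by rw [value_over_zero_parallel, h, hw, mul_left_comm]), h]
    · have h := value_under_zero_crossed hw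
      rw [ih (by rw [value_under_zero_parallel, h, hw, mul_left_comm]), h]

/-! ### The two halves of K_D and the final evaluation. -/

/-- Replacing the strands `i`, `i + 1` by a maximum below a minimum, for the three ways of joining
four strands in pairs. -/
theorem act_cup_cap :
    (Piece.cup 0).act ((Piece.cap 0).act [0, 0, 2, 2]) = [0, 0, 2, 2] ∧
    (Piece.cup 0).act ((Piece.cap 0).act [0, 1, 0, 1]) = [0, 0, 2, 2] ∧
    (Piece.cup 0).act ((Piece.cap 0).act [0, 1, 1, 0]) = [0, 0, 2, 2] ∧
    (Piece.cup 1).act ((Piece.cap 1).act [0, 0, 2, 2]) = [0, 1, 1, 0] ∧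
    (Piece.cup 1).act ((Piece.cap 1).act [0, 1, 0, 1]) = [0, 1, 1, 0] ∧
    (Piece.cup 1).act ((Piece.cap 1).act [0, 1, 1, 0]) = [0, 1, 1, 0] ∧
    (Piece.cup 2).act ((Piece.cap 2).act [0, 0, 2, 2]) = [0, 0, 2, 2] ∧
    (Piece.cup 2).act ((Piece.cap 2).act [0, 1, 0, 1]) = [0, 0, 2, 2] ∧
    (Piece.cup 2).act ((Piece.cap 2).act [0, 1, 1, 0]) = [0, 0, 2, 2] := by
  decide

theorem act_cap_one :
    (Piece.cap 1).act [0, 0, 2, 2] = [0, 0] ∧ (Piece.cap 1).act [0, 1, 0, 1] = [0, 0] ∧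
    (Piece.cap 1).act [0, 1, 1, 0] = [0, 0] := by
  decide

theorem act_cup_one : (Piece.cup 1).act [0, 0] = [0, 1, 1, 0] := by decide

theorem loops_cap :
    (Piece.cap 0).loops [0, 0, 2, 2] = 1 ∧ (Piece.cap 0).loops [0, 1, 0, 1] = 0 ∧
    (Piece.cap 0).loops [0, 1, 1, 0] = 0 ∧ (Piece.cap 1).loops [0, 0, 2, 2] = 0 ∧
    (Piece.cap 1).loops [0, 1, 0, 1] = 0 ∧ (Piece.cap 1).loops [0, 1, 1, 0] = 1 ∧
    (Piece.cap 2).loops [0, 0, 2, 2] = 1 ∧ (Piece.cap 2).loops [0, 1, 0, 1] = 0 ∧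
    (Piece.cap 2).loops [0, 1, 1, 0] = 0 := by
  decide

theorem loops_cup (i : ℕ) (m : List ℕ) : (Piece.cup i).loops m = 0 := rfl

/-- Together with `value_lower_half_crossed` this is the hypothesis of `value_twist_crossed`. After
the maximum only the pairing `[0, 0]` is left, so the claim is an identity for its coefficient, a
polynomial in A and B = A⁻¹ modulo AB = 1. -/
theorem value_lower_half_parallel (w : List Slice) :
    value (.under 1 :: .over 0 :: .under 2 :: .under 2 :: .plain (.cap 1) :: w) [0, 0, 2, 2] =
      d * value w [0, 0] := by
  have h := T_mul_T_neg
  simp only [value, act_cup_cap, act_cap_one, act_cup_one, loops_cap, pow_zero, pow_one, one_mul,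
    d_eq]
  generalize value w [0, 0] = X
  generalize (T 1 : LaurentPolynomial ℤ) = A at *
  generalize (T (-1) : LaurentPolynomial ℤ) = B at *
  grind

theorem value_lower_half_crossed (w : List Slice) :
    value (.under 1 :: .over 0 :: .under 2 :: .under 2 :: .plain (.cap 1) :: w) [0, 1, 0, 1] =
      value w [0, 0] := by
  have h := T_mul_T_neg
  simp only [value, act_cup_cap, act_cap_one, act_cup_one, loops_cap, pow_zero, pow_one, one_mul,
    d_eq]
  generalize value w [0, 0] = X
  generalize (T 1 : LaurentPolynomial ℤ) = A at *
  generalize (T (-1) : LaurentPolynomial ℤ) = B at *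
  grind

/-- Expanding the four crossings gives only the parallel and the nested pairing; the coefficient of
the nested one cancels and that of the parallel one is 1. -/
theorem value_upper_half (w : List Slice) :
    value (.plain (.cup 1) :: .over 2 :: .over 2 :: .under 0 :: .over 1 :: w) [0, 0] =
      value w [0, 0, 2, 2] := by
  have h := T_mul_T_neg
  simp only [value, act_cup_cap, act_cup_one, loops_cap, loops_cup, pow_zero, pow_one, one_mul,
    d_eq]
  generalize value w [0, 0, 2, 2] = X
  generalize value w [0, 1, 1, 0] = Y
  generalize (T 1 : LaurentPolynomial ℤ) = A at *
  generalize (T (-1) : LaurentPolynomial ℤ) = B at *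
  grind

theorem value_kdWord (t : ℤ) : value (kdWord t) [] = d := by
  have htop : value [.plain (.virt 1), .plain (.cap 2), .plain (.cap 0)] [0, 0, 2, 2] = d := by
    have h₁ : (Piece.virt 1).act [0, 0, 2, 2] = [0, 1, 0, 1] := by decide
    have h₂ : (Piece.cap 2).act [0, 1, 0, 1] = [0, 0] := by decide
    have h₃ : (Piece.cap 0).loops [0, 0] = 1 := by decide
    have h₄ : (Piece.virt 1).loops [0, 0, 2, 2] = 0 := by decide
    simp only [value, h₁, h₂, h₃, h₄, loops_cap, pow_zero, pow_one, one_mul, mul_one]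
  have hbottom (w : List Slice) :
      value (.plain (.cup 0) :: .plain (.cup 2) :: .plain (.virt 1) :: w) [] =
        value w [0, 1, 0, 1] := by
    have h₁ : (Piece.virt 1).act ((Piece.cup 2).act ((Piece.cup 0).act [])) = [0, 1, 0, 1] := by
      decide
    simp only [value, Piece.loops, h₁, pow_zero, one_mul]
  simp only [kdWord, List.append_assoc, List.cons_append, List.nil_append]
  rw [hbottom, value_twist_crossed, value_lower_half_crossed, value_upper_half,
    value_twist_parallel, htop, ← mul_assoc, twistFactor_mul_neg, one_mul]
  -- What remains is the hypothesis of `value_twist_crossed` for everything above the first twists.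
  rw [value_lower_half_parallel, value_lower_half_crossed]

theorem bracket_KD (t : ℤ) : (KD t).bracket = 1 :=
  bracket_eq_one _ rfl (value_kdWord t)

end VirtualKnot

theorem mainTheorem4 (t : ℤ) :
    (VirtualKnot.KD t).bracket = 1 ∧
      (VirtualKnot.KD t).bracket = VirtualKnot.unknot.bracket := by
  rw [VirtualKnot.bracket_KD, VirtualKnot.bracket_unknot]
  exact ⟨rfl, rfl⟩
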